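/- Model. A mechanism $M$ with $n$ credentials interacts with two players, a user and an attacker; the players carry identifiers $0$ and $1$, and the mechanism tries to decide which identifier belongs to the user. Credential $i$ has a public part, drawn by the credential generator of $M$ and known to $M$, and an ideal secret part: a player can present credential $i$ in a message exactly when it is available to her (it cannot be forged or guessed). A scenario is a pair $\sigma=(\sigma_U,\sigma_A)\in\{0,1\}^n\times\{0,1\}^n$ of availability vectors, of the user and of the attacker. A mechanism and the strategies of the two players are deterministic state machines that read their random bits, when needed, from a common infinite random tape $v$; a strategy of a player may present only credentials that are available to her. In each discrete time step each player, and then the mechanism, handles the messages delivered to it in this step, followed by an empty message; what is sent becomes pending. A scheduler $\gamma$ chooses the identifier of the user (the attacker gets the other one) and, in each step, which pending messages are delivered and in which order; it does not see the contents of messages. Communication is reliable but asynchronous: every message is eventually delivered, with no bound on the delay. The execution ends as soon as the mechanism decides an identifier, and the player with this identifier wins. $M$ is successful in $\sigma$ if there is a user strategy $S_U$ such that for all attacker strategies $S_A$, all schedulers $\gamma$ and all random tapes $v$, the user wins the execution $(M,\sigma,S_U,S_A,\gamma,v)$. The profile $\mathrm{Prof}(M)$ is the set of all scenarios in which $M$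 is successful. For mechanisms with the same number of credentials, $M_1$ dominates $M_2$ if $\mathrm{Prof}(M_2)\subseteq\mathrm{Prof}(M_1)$, and strictly dominates $M_2$ if $\mathrm{Prof}(M_2)\subsetneq\mathrm{Prof}(M_1)$. For $f:\{0,1\}^n\to\{0,1\}$, the Boolean mechanism $M_f$ (with any ideal credential generator) decides upon the first message that it receives, say from the player with identifier $i$: it decides $i$ if the message presents a valid set of credentials whose availability vector $q$ satisfies $f(q)=1$, and it decides $1-i$ otherwise. Theorem. Let $f:\{0,1\}^n\to\{0,1\}$ be a non-constant monotone Boolean function. Then $M_f$ is maximal: no mechanism with $n$ credentials strictly dominates $M_f$. Equivalently, every mechanism $M'$ with $n$ credentials that dominates $M_f$ satisfies $\mathrm{Prof}(M')=\mathrm{Prof}(M_f)$. -/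

import Mathlib

namespace AsyncAuth

/-! ### Randomness -/

/-- A random tape: an infinite stream of bits. -/
abbrev Tape := ℕ → Bool

/-- A terminating computation that draws random bits one at a time and returns a value in `α`. -/
inductive Coin (α : Type) : Type where
  | ret (a : α) : Coin α
  | flip (k : Bool → Coin α) : Coin α

namespace Coin

def bind {α β : Type} : Coin α → (α → Coin β) → Coin β
  | ret a, g => g a
  | flip k, g => flip fun b => (k b).bind g

instance : Monad Coin where
  pure := ret
  bind := bind

/-- Run on a tape: every coin is the next bit of the tape. Returns the value and the unread tape. -/
def run {α : Type} : Coin α → Tape → α × Tape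
  | ret a, v => (a, v)
  | flip k, v => (k (v 0)).run fun j => v (j + 1)

/-- Every possible outcome satisfies `p`. -/
def Always {α : Type} (p : α → Prop) : Coin α → Prop
  | ret a => p a
  | flip k => ∀ b, (k b).Always p

end Coin

/-! ### Credentials, scenarios and messages -/

/-- Availability of each of the `n` credentials to a player. -/
abbrev Availability (n : ℕ) := Fin n → Bool

/-- A scenario: the availability vectors of the user and of the attacker. -/
structure Scenario (n : ℕ) where
  user : Availability n
  attacker : Availability n

/-- Plain data. -/
abbrev Text := List Bool

/-- The public part of a credential. -/
abbrev PublicPart := List Bool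

/-- What a message can present as a credential. Credentials are ideal: the secret part of the
`i`-th credential (equivalently, a proof that one holds it) is an atom `secret i`, different from
every string that a player can make up by herself. The mechanism, which knows the public parts,
recognises it. `bogus s` is any string that is not the secret part of one of the credentials. -/
inductive Presented (n : ℕ) : Type where
  | secret (i : Fin n) : Presented n
  | bogus (s : Text) : Presented n
deriving DecidableEq

/-- A message from a player to the mechanism: arbitrary data and a set of presented
credentials. -/
structure Message (n : ℕ) where
  text : Text
  creds : Finset (Presented n)

/-- The message presents nothing but genuine credentials. -/
def Message.Valid {n : ℕ} (m : Message n) : Prop :=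
  ∀ c ∈ m.creds, ∃ i, c = Presented.secret i

/-- The availability vector of the credentials presented in the message. -/
def Message.availability {n : ℕ} (m : Message n) : Availability n :=
  fun i => decide (Presented.secret i ∈ m.creds)

/-- A player whose availability vector is `a` is able to send the message: all secret parts in it
are available to her. -/
def Message.SendableBy {n : ℕ} (m : Message n) (a : Availability n) : Prop :=
  ∀ i, Presented.secret i ∈ m.creds → a i = true

/-! ### Mechanisms and strategies -/

/-- Player identifiers `0` (`false`) and `1` (`true`). -/
abbrev PlayerId := Bool

/-- An ideal credential generator: it draws the public parts of the `n` credentials; the secret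
part of the `i`-th credential is the ideal atom `Presented.secret i`. -/
abbrev Generator (n : ℕ) := Coin (Fin n → PublicPart)

/-- The result of one call of the step function of a mechanism: the new state, the new value of the
decision variable (`none` for no decision), and the messages to send to the two players. -/
structure Reaction (State : Type) where
  state : State
  decision : Option PlayerId
  out : PlayerId → List Text

/-- An authentication mechanism with `n` credentials. The initial state is given the public parts.
The step function is given the state, the current time and either `none` (no message was received)
or a message together with the identifier of its sender. -/
structure Mechanism (n : ℕ) where
  State : Type
  gen : Generator n
  init : (Fin n → PublicPart) → State
  step : State → ℕ → Option (PlayerId × Message n) → Coin (Reaction State)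

/-- A player strategy. The step function is given the state, the current time and either `none`
(no message) or a message from the mechanism, and returns the new state and the messages to send. -/
structure Strategy (n : ℕ) where
  State : Type
  init : State
  step : State → ℕ → Option Text → Coin (State × List (Message n))

/-- The strategy uses only credentials that are available according to `a`. -/
def Strategy.Uses {n : ℕ} (S : Strategy n) (a : Availability n) : Prop :=
  ∀ s t m, (S.step s t m).Always fun r => ∀ x ∈ r.2, x.SendableBy a

/-! ### Schedulers -/

/-- The recipients of messages. -/
inductive Entity : Type where
  | mechanism : Entity
  | player (i : PlayerId) : Entity

/-- What the scheduler sees of a pending message: its sender and when it was sent. -/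
structure Header where
  sender : Entity
  sentAt : ℕ

/-- A pending message. -/
structure Packet (β : Type) where
  header : Header
  body : β

/-- What the ordering function sees: the current time, the entity to which messages are about to be
delivered, and the headers of all pending messages. -/
structure View where
  time : ℕ
  target : Entity
  pending : Entity → List Header

/-- A scheduler: the identifier of the user (the attacker gets the other one), the ordering
function, and the random tape of the ordering function. The ordering function returns the positions
(in the list of messages pending for the target) of the messages to deliver now, in the order of
delivery. -/
structure Scheduler where
  userId : PlayerId
  ord : Tape → View → List ℕ
  tape : Tape

/-- The messages at the chosen positions, in the chosen order, each at most once. -/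
def delivered {β : Type} (l : List ℕ) (p : List (Packet β)) : List (Packet β) :=
  l.dedup.filterMap fun k => p[k]?

/-- The messages that remain pending. -/
def remaining {β : Type} (l : List ℕ) (p : List (Packet β)) : List (Packet β) :=
  (p.zipIdx.filter fun x => decide (x.2 ∉ l)).map Prod.fst

/-! ### Executions -/

/-- A player handles a list of inputs; all messages that she sends are collected. -/
def Strategy.receive {n : ℕ} (S : Strategy n) (t : ℕ) :
    S.State → List (Option Text) → Coin (S.State × List (Message n))
  | s, [] => pure (s, [])
  | s, m :: ms => do
      let r ← S.step s t m
      let r' ← S.receive t r.1 ms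
      pure (r'.1, r.2 ++ r'.2)

/-- The mechanism handles a list of inputs, and stops as soon as it decides. -/
def Mechanism.receive {n : ℕ} (M : Mechanism n) (t : ℕ) :
    M.State → List (Option (PlayerId × Message n)) → Coin (Reaction M.State)
  | s, [] => pure ⟨s, none, fun _ => []⟩
  | s, m :: ms => do
      let r ← M.step s t m
      match r.decision with
      | some _ => pure r
      | none => do
          let r' ← M.receive t r.state ms
          pure ⟨r'.state, r'.decision, fun i => r.out i ++ r'.out i⟩

/-- The state of an execution of `M` with the strategy `S i` for the player with identifier `i`. -/
structure Config {n : ℕ} (M : Mechanism n) (S : PlayerId → Strategy n) where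
  decision : Option PlayerId
  mech : M.State
  player : (i : PlayerId) → (S i).State
  toMech : List (Packet (PlayerId × Message n))
  toPlayer : PlayerId → List (Packet Text)

section Execution

variable {n : ℕ} (M : Mechanism n) (S : PlayerId → Strategy n) (γ : Scheduler)

/-- Setup: the credentials are generated and the mechanism receives the public parts. -/
def setup : Coin (Config M S) := do
  let pub ← M.gen
  pure { decision := none
         mech := M.init pub
         player := fun i => (S i).init
         toMech := []
         toPlayer := fun _ => [] }

/-- The positions of the messages that the scheduler delivers to `e` at time `t`. -/
def chosen (t : ℕ) (c : Config M S) (e : Entity) : List ℕ :=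
  γ.ord γ.tape
    { time := t
      target := e
      pending := fun e' => match e' with
        | .mechanism => c.toMech.map Packet.header
        | .player i => (c.toPlayer i).map Packet.header }

/-- The iteration of the main loop at time `t`. The scheduler chooses the messages to deliver; each
list of delivered messages is followed by an empty message. Then player `0`, player `1` and the
mechanism handle their lists, and what they send becomes pending for the next iterations. Nothing
happens any more once the mechanism has decided. -/
def round (t : ℕ) (c : Config M S) : Coin (Config M S) :=
  match c.decision with
  | some _ => pure c
  | none => do
      let lM := chosen M S γ t c .mechanism
      let lP := fun i => chosen M S γ t c (.player i)
      let input := fun i =>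
        (delivered (lP i) (c.toPlayer i)).map (fun p => some p.body) ++ [none]
      let r0 ← (S false).receive t (c.player false) (input false)
      let r1 ← (S true).receive t (c.player true) (input true)
      let r ← M.receive t c.mech
        ((delivered lM c.toMech).map (fun p => some p.body) ++ [none])
      pure { decision := r.decision
             mech := r.state
             player := fun i => match i with
               | false => r0.1
               | true => r1.1
             toMech := remaining lM c.toMech
               ++ r0.2.map (fun m => ⟨⟨.player false, t⟩, (false, m)⟩)
               ++ r1.2.map (fun m => ⟨⟨.player true, t⟩, (true, m)⟩)
             toPlayer := fun i => remaining (lP i) (c.toPlayer i)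
               ++ (r.out i).map (fun m => ⟨⟨.mechanism, t⟩, m⟩) }

/-- The execution up to (not including) time `t`. -/
def execute : ℕ → Coin (Config M S)
  | 0 => setup M S
  | t + 1 => do
      let c ← execute t
      round M S γ t c

end Execution

/-- The scheduler assigns its user identifier to the user and the other one to the attacker. -/
def assign {n : ℕ} (γ : Scheduler) (SU SA : Strategy n) : PlayerId → Strategy n :=
  fun i => if i = γ.userId then SU else SA

/-- The state at time `t` of the execution `(M, σ, SU, SA, γ, v)`; the scenario restricts which
strategies are allowed. -/
def stateAt {n : ℕ} (M : Mechanism n) (SU SA : Strategy n) (γ : Scheduler) (v : Tape) (t : ℕ) :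
    Config M (assign γ SU SA) :=
  ((execute M (assign γ SU SA) γ t).run v).1

/-- Reliable communication: unless the execution ends, every message is eventually delivered, i.e.
for every `k`, at some time no message that was sent before time `k` is pending any more. -/
def Reliable {n : ℕ} (M : Mechanism n) (SU SA : Strategy n) (γ : Scheduler) (v : Tape) : Prop :=
  ∀ k : ℕ, ∃ t ≥ k, (stateAt M SU SA γ v t).decision ≠ none ∨
    ((∀ p ∈ (stateAt M SU SA γ v t).toMech, k ≤ p.header.sentAt) ∧
      ∀ i, ∀ p ∈ (stateAt M SU SA γ v t).toPlayer i, k ≤ p.header.sentAt)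

/-- The user wins: at some time the mechanism decides the identifier of the user. -/
def UserWins {n : ℕ} (M : Mechanism n) (SU SA : Strategy n) (γ : Scheduler) (v : Tape) : Prop :=
  ∃ t, (stateAt M SU SA γ v t).decision = some γ.userId

/-! ### Success, profiles and the order of mechanisms -/

/-- The mechanism is successful in the scenario `σ`: some user strategy wins against all attacker
strategies, all (reliable) schedulers and all random tapes. -/
def Mechanism.Successful {n : ℕ} (M : Mechanism n) (σ : Scenario n) : Prop :=
  ∃ SU : Strategy n, SU.Uses σ.user ∧
    ∀ SA : Strategy n, SA.Uses σ.attacker →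
      ∀ (γ : Scheduler) (v : Tape), Reliable M SU SA γ v → UserWins M SU SA γ v

/-- The profile of a mechanism: the set of all scenarios in which it is successful. -/
def Mechanism.profile {n : ℕ} (M : Mechanism n) : Set (Scenario n) :=
  {σ | M.Successful σ}

/-- `M₁` dominates `M₂`. -/
def Dominates {n : ℕ} (M₁ M₂ : Mechanism n) : Prop :=
  M₂.profile ⊆ M₁.profile

/-- `M₁` strictly dominates `M₂`. -/
def StrictlyDominates {n : ℕ} (M₁ M₂ : Mechanism n) : Prop :=
  M₂.profile ⊂ M₁.profile

/-- `M₁` and `M₂` are equivalent. -/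
def Equivalent {n : ℕ} (M₁ M₂ : Mechanism n) : Prop :=
  M₁.profile = M₂.profile

/-- `M` is maximal: no mechanism with the same number of credentials strictly dominates it. -/
def Mechanism.Maximal {n : ℕ} (M : Mechanism n) : Prop :=
  ¬ ∃ M' : Mechanism n, StrictlyDominates M' M

/-! ### Boolean mechanisms -/

open Classical in
/-- The Boolean mechanism of `f` with credential generator `g`. On its first message, from player
`i`, it decides `i` if the message presents a valid set of credentials with availability vector `q`
and `f q = 1`, and the other player `1 - i` otherwise. It sends no messages. -/
noncomputable def booleanMechanism {n : ℕ} (g : Generator n) (f : Availability n → Bool) :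
    Mechanism n where
  State := Unit
  gen := g
  init := fun _ => ()
  step := fun _ _ x => match x with
    | none => pure ⟨(), none, fun _ => []⟩
    | some (i, m) =>
        pure ⟨(), some (if m.Valid ∧ f m.availability = true then i else !i), fun _ => []⟩

end AsyncAuth

/-! Asynchrony yields an obstruction: no mechanism succeeds in two scenarios where the user of one
holds the same credentials as the attacker of the other. Let winning strategies `S₀`, `S₁` of the
two users play each other while the messages of `S₁` are delayed. To the mechanism this looks like
`S₀` against a silent attacker, so it must decide for `S₀`. That decision ends the execution, so the
delay violates no reliability requirement, yet in the second scenario `S₀` is a legitimate attacker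
and has won (`Mechanism.Successful.not_of_user_eq_attacker`). A monotone `f` makes `M_f` succeed
whenever `f` is 1 at the user and 0 at the attacker (`booleanMechanism_successful`). If a dominating
mechanism succeeded anywhere else, non-constancy of `f` would supply a second scenario, in the
profile of `M_f`, that triggers the obstruction. -/

namespace AsyncAuth

/-! ### Random computations -/

namespace Coin

@[simp]
theorem run_pure {α : Type} (a : α) (v : Tape) : (pure a : Coin α).run v = (a, v) := rfl

@[simp]
theorem run_bind {α β : Type} (c : Coin α) (g : α → Coin β) (v : Tape) :
    (c >>= g).run v = (g (c.run v).1).run (c.run v).2 := by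
  change (c.bind g).run v = _
  induction c generalizing v with
  | ret a => rfl
  | flip k ih => exact ih _ _

theorem Always.run {α : Type} {p : α → Prop} {c : Coin α} (h : c.Always p) (v : Tape) :
    p (c.run v).1 := by
  induction c generalizing v with
  | ret a => exact h
  | flip k ih => exact ih _ (h _) _

theorem Always.bind {α β : Type} {p : α → Prop} {q : β → Prop} {c : Coin α} {g : α → Coin β}
    (h : c.Always p) (hg : ∀ a, p a → (g a).Always q) : (c >>= g).Always q := by
  change (c.bind g).Always q
  induction c with
  | ret a => exact hg a h
  | flip k ih => exact fun b => ih b (h b)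

theorem Always.mono {α : Type} {p q : α → Prop} {c : Coin α} (h : c.Always p)
    (hpq : ∀ a, p a → q a) : c.Always q := by
  induction c with
  | ret a => exact hpq a h
  | flip k ih => exact fun b => ih b (h b)

end Coin

/-! ### Delivery -/

theorem remaining_subset {β : Type} (l : List ℕ) (p : List (Packet β)) : remaining l p ⊆ p := by
  intro x hx
  simp only [remaining, List.mem_map, List.mem_filter] at hx
  obtain ⟨⟨y, k⟩, ⟨hy, -⟩, rfl⟩ := hx
  exact List.mem_of_getElem? (List.mem_zipIdx_iff_getElem?.1 hy)

theorem delivered_subset {β : Type} (l : List ℕ) (p : List (Packet β)) : delivered l p ⊆ p := by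
  intro x hx
  obtain ⟨k, -, hk⟩ := List.mem_filterMap.1 hx
  exact List.mem_of_getElem? hk

/-- If nothing is delivered, all chosen positions are out of range, so nothing is removed either. -/
theorem mem_remaining_of_delivered_eq_nil {β : Type} {l : List ℕ} {p : List (Packet β)}
    (h : delivered l p = []) {x : Packet β} (hx : x ∈ p) : x ∈ remaining l p := by
  obtain ⟨k, hk⟩ := List.mem_iff_getElem?.1 hx
  simp only [remaining, List.mem_map, List.mem_filter]
  refine ⟨(x, k), ⟨List.mem_zipIdx_iff_getElem?.2 hk, ?_⟩, rfl⟩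
  have := List.filterMap_eq_nil_iff.1 h k
  simp only [List.mem_dedup, hk] at this
  simpa using this

/-- The positions of the headers that satisfy `q`. -/
def positions (q : Header → Bool) (l : List Header) : List ℕ :=
  (List.range l.length).filter fun k => l[k]?.any q

/-- The positions are increasing and distinct, so neither deduplication nor reordering has any
effect. -/
theorem delivered_positions {β : Type} (q : Header → Bool) (p : List (Packet β)) :
    delivered (positions q (p.map Packet.header)) p = p.filter fun x => q x.header := by
  have h : (List.range p.length).filterMap (fun k => p[k]?) = p := by
    induction p with
    | nil => rfl
    | cons a p ih => simpa [List.range_succ_eq_map, List.filterMap_map, Function.comp_def] using ih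
  have hd : (positions q (p.map Packet.header)).Nodup := List.nodup_range.filter _
  rw [delivered, hd.dedup, positions, List.filterMap_filter]
  conv_rhs => rw [← h, List.filter_filterMap]
  rw [List.length_map]
  refine List.filterMap_congr fun k _ => ?_
  rw [List.getElem?_map]
  cases p[k]? <;> simp [Option.filter]

theorem remaining_positions {β : Type} (q : Header → Bool) (p : List (Packet β)) :
    remaining (positions q (p.map Packet.header)) p = p.filter fun x => !q x.header := by
  conv_rhs => rw [← List.zipIdx_map_fst 0 p, List.filter_map]
  rw [remaining]
  congr 1
  refine List.filter_congr fun x hx => ?_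
  obtain ⟨hlt, hx'⟩ := List.getElem?_eq_some_iff.1 (List.mem_zipIdx_iff_getElem?.1 hx)
  simp [positions, hlt, hx']

/-! ### Executions -/

section Execution

variable {n : ℕ} (M : Mechanism n)

theorem round_of_decided (S : PlayerId → Strategy n) (γ : Scheduler) (t : ℕ) (c : Config M S)
    {d : PlayerId} (h : c.decision = some d) : round M S γ t c = pure c := by
  simp only [round, h]

theorem decision_mono (S : PlayerId → Strategy n) (γ : Scheduler) (v : Tape) {t t' : ℕ}
    (htt : t ≤ t') {d : PlayerId} (h : ((execute M S γ t).run v).1.decision = some d) :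
    ((execute M S γ t').run v).1.decision = some d := by
  induction t', htt using Nat.le_induction with
  | base => exact h
  | succ t' _ ih =>
    rw [execute, Coin.run_bind, round_of_decided M S γ t' _ ih]
    exact ih

/-- Every message that the strategy sends satisfies `P`. -/
def Strategy.Sends (S : Strategy n) (P : Message n → Prop) : Prop :=
  ∀ s t m, (S.step s t m).Always fun r => ∀ x ∈ r.2, P x

theorem Strategy.Sends.receive {S : Strategy n} {P : Message n → Prop} (h : S.Sends P) (t : ℕ)
    (s : S.State) (ms : List (Option Text)) :
    (S.receive t s ms).Always fun r => ∀ x ∈ r.2, P x := by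
  induction ms generalizing s with
  | nil => intro x hx; cases hx
  | cons m ms ih =>
    refine (h s t m).bind fun r hr => (ih r.1).bind fun r' hr' => ?_
    intro x hx
    exact (List.mem_append.1 hx).elim (hr x) (hr' x)

/-- The strategy `S` with all outgoing messages suppressed. -/
def Strategy.mute (S : Strategy n) : Strategy n where
  State := S.State
  init := S.init
  step := fun s t m => do
    let r ← S.step s t m
    pure (r.1, [])

/-- Vacuous; it makes a muted strategy legitimate for every availability vector. -/
theorem Strategy.mute_sends (S : Strategy n) (P : Message n → Prop) : S.mute.Sends P := by
  intro s t m
  refine Coin.Always.bind (p := fun _ => True) ?_ fun r _ x hx => by cases hx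
  generalize S.step s t m = c
  induction c with
  | ret a => trivial
  | flip k ih => exact ih

/-- Muting consumes the same random bits. This matters because all entities read one common tape. -/
theorem Strategy.mute_receive_run (S : Strategy n) (t : ℕ) (s : S.State) (ms : List (Option Text))
    (v : Tape) : (S.mute.receive t s ms).run v =
      ((((S.receive t s ms).run v).1.1, []), ((S.receive t s ms).run v).2) := by
  induction ms generalizing s v with
  | nil => rfl
  | cons m ms ih =>
    have h : (S.mute.step s t m).run v
        = ((((S.step s t m).run v).1.1, []), ((S.step s t m).run v).2) := by
      simp [Strategy.mute]
    simp only [Strategy.receive, Coin.run_bind, Coin.run_pure, h, ih, List.append_nil]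
    rfl

/-! ### Delaying one player -/

/-- The strategies of the players with identifiers `0` and `1`. -/
def versus (S₀ S₁ : Strategy n) : PlayerId → Strategy n
  | false => S₀
  | true => S₁

/-- The header belongs to a message of player `0`. -/
def Header.fromZero (h : Header) : Bool :=
  match h.sender with
  | .player false => true
  | _ => false

/-- The scheduler that delays the messages of player `1` forever and delivers all the others
at once. -/
def delayOne (u : PlayerId) : Scheduler where
  userId := u
  ord := fun _ w => match w.target with
    | .mechanism => positions Header.fromZero (w.pending .mechanism)
    | .player i => positions (fun _ => true) (w.pending (.player i))
  tape := fun _ => false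

theorem chosen_delayOne_mechanism (S : PlayerId → Strategy n) (u : PlayerId) (t : ℕ)
    (c : Config M S) : chosen M S (delayOne u) t c .mechanism
      = positions Header.fromZero (c.toMech.map Packet.header) := rfl

theorem chosen_delayOne_player (S : PlayerId → Strategy n) (u : PlayerId) (t : ℕ)
    (c : Config M S) (i : PlayerId) : chosen M S (delayOne u) t c (.player i)
      = positions (fun _ => true) ((c.toPlayer i).map Packet.header) := rfl

variable {M} in
/-- Two configurations agree except for pending messages of player `1`. -/
structure Config.SameUpToOne {S₀ S₁ : Strategy n} (c : Config M (versus S₀ S₁.mute))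
    (c' : Config M (versus S₀ S₁)) : Prop where
  decision : c.decision = c'.decision
  mech : c.mech = c'.mech
  player_zero : (c.player false : S₀.State) = c'.player false
  player_one : (c.player true : S₁.State) = c'.player true
  toMech : c.toMech.filter (fun p => p.header.fromZero)
    = c'.toMech.filter (fun p => p.header.fromZero)
  toPlayer : c.toPlayer = c'.toPlayer

/-- `delayOne` passes only messages of player `0` to the mechanism, and a round never consults the
identifier of the user. Equality of the unread tapes carries the induction on time. -/
theorem round_sameUpToOne (S₀ S₁ : Strategy n) (u u' : PlayerId) (t : ℕ) (v : Tape)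
    (c : Config M (versus S₀ S₁.mute)) (c' : Config M (versus S₀ S₁)) (h : c.SameUpToOne c') :
    ((round M _ (delayOne u) t c).run v).1.SameUpToOne
        ((round M _ (delayOne u') t c').run v).1 ∧
      ((round M _ (delayOne u) t c).run v).2 = ((round M _ (delayOne u') t c').run v).2 := by
  obtain ⟨d, m, p, q, r⟩ := c
  obtain ⟨d', m', p', q', r'⟩ := c'
  obtain ⟨h1, h2, h3, h4, h5, h6⟩ := h
  dsimp only at h1 h2 h3 h4 h5 h6
  subst h1 h2 h6
  cases d with
  | some d => exact ⟨⟨rfl, rfl, h3, h4, h5, rfl⟩, rfl⟩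
  | none =>
    simp only [round, Coin.run_bind, Coin.run_pure, chosen_delayOne_mechanism,
      chosen_delayOne_player, delivered_positions, remaining_positions]
    -- The state types agree only after unfolding `versus`, so the equalities go through
    -- definitional unfolding.
    have e0 : ∀ ms w, ((versus S₀ S₁.mute false).receive t (p false) ms).run w
        = ((versus S₀ S₁ false).receive t (p' false) ms).run w := by
      intro ms w
      exact congrArg (fun s => (S₀.receive t s ms).run w) h3
    have e1 : ∀ ms w, ((versus S₀ S₁.mute true).receive t (p true) ms).run w
        = ((((S₁.receive t (p' true) ms).run w).1.1, []),
          ((S₁.receive t (p' true) ms).run w).2) := by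
      intro ms w
      exact (S₁.mute_receive_run t (p true) ms w).trans
        (congrArg (fun s => ((((S₁.receive t s ms).run w).1.1, ([] : List (Message n))),
          ((S₁.receive t s ms).run w).2)) h4)
    simp only [e0, e1, h5]
    refine ⟨⟨rfl, rfl, rfl, rfl, ?_, rfl⟩, rfl⟩
    -- The filter drops all leftovers and the new messages of player `1`; both sides keep just the
    -- new messages of player `0`.
    simp [Header.fromZero, List.filter_append, List.filter_map, Function.comp_def,
      List.filter_filter]

theorem execute_sameUpToOne (S₀ S₁ : Strategy n) (u u' : PlayerId) (t : ℕ) (v : Tape) :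
    ((execute M (versus S₀ S₁.mute) (delayOne u) t).run v).1.SameUpToOne
        ((execute M (versus S₀ S₁) (delayOne u') t).run v).1 ∧
      ((execute M (versus S₀ S₁.mute) (delayOne u) t).run v).2
        = ((execute M (versus S₀ S₁) (delayOne u') t).run v).2 := by
  induction t with
  | zero =>
    simp only [execute, setup, Coin.run_bind, Coin.run_pure, and_true]
    exact ⟨rfl, rfl, rfl, rfl, rfl, rfl⟩
  | succ t ih =>
    simp only [execute, Coin.run_bind]
    rw [ih.2]
    exact round_sameUpToOne M S₀ S₁ u u' t _ _ _ ih.1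

/-- If player `1` is mute, then `delayOne` leaves no message undelivered for more than one step. -/
theorem execute_mute_pending (S₀ S₁ : Strategy n) (u : PlayerId) (t : ℕ) (v : Tape) :
    ((execute M (versus S₀ S₁.mute) (delayOne u) t).run v).1.decision ≠ none ∨
      ((∀ p ∈ ((execute M (versus S₀ S₁.mute) (delayOne u) t).run v).1.toMech,
          p.header.fromZero ∧ t ≤ p.header.sentAt + 1) ∧
        ∀ i, ∀ p ∈ ((execute M (versus S₀ S₁.mute) (delayOne u) t).run v).1.toPlayer i,
          t ≤ p.header.sentAt + 1) := by
  induction t with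
  | zero => right; simp [execute, setup]
  | succ t ih =>
    simp only [execute, Coin.run_bind]
    generalize (execute M (versus S₀ S₁.mute) (delayOne u) t).run v = x at ih
    obtain ⟨⟨d, m, p, q, r⟩, w⟩ := x
    dsimp only at ih ⊢
    cases d with
    | some d => left; simp [round]
    | none =>
      right
      replace ih := ih.resolve_left (by simp)
      -- Everything pending comes from player `0`, so the whole queue is delivered and only messages
      -- sent at time `t` are pending afterwards.
      have hq : (q.filter fun x => !x.header.fromZero) = [] := by
        simpa using fun a ha => (ih.1 a ha).1
      have e1 : ∀ ms w, (((versus S₀ S₁.mute true).receive t (p true) ms).run w).1.2 = [] := by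
        intro ms w
        exact congrArg (fun z => z.1.2) (S₁.mute_receive_run t (p true) ms w)
      simp only [round, Coin.run_bind, Coin.run_pure, chosen_delayOne_mechanism,
        chosen_delayOne_player, delivered_positions, remaining_positions, hq, e1]
      constructor
      · simp +contextual [Header.fromZero]
      · simp +contextual

/-! ### The obstruction from two scenarios -/

theorem assign_false (γ : Scheduler) (h : γ.userId = false) (SU SA : Strategy n) :
    assign γ SU SA = versus SU SA := by
  funext i; cases i <;> simp [assign, versus, h]

theorem assign_true (γ : Scheduler) (h : γ.userId = true) (SU SA : Strategy n) :
    assign γ SU SA = versus SA SU := by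
  funext i; cases i <;> simp [assign, versus, h]

variable {M} in
-- The type of configurations depends on the strategies, so `assign` is replaced everywhere at once
-- by substitution.
theorem exists_decision_eq {SU SA : Strategy n} {γ : Scheduler} {v : Tape}
    {S : PlayerId → Strategy n} (hS : assign γ SU SA = S)
    (hwin : Reliable M SU SA γ v → UserWins M SU SA γ v)
    (hrel : ∀ k : ℕ, ∃ t ≥ k, ((execute M S γ t).run v).1.decision ≠ none ∨
      ((∀ p ∈ ((execute M S γ t).run v).1.toMech, k ≤ p.header.sentAt) ∧
        ∀ i, ∀ p ∈ ((execute M S γ t).run v).1.toPlayer i, k ≤ p.header.sentAt)) :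
    ∃ t, ((execute M S γ t).run v).1.decision = some γ.userId := by
  subst hS
  exact hwin hrel

/-- A mechanism cannot be successful both when a player with availability `a` is the user and when
she is the attacker. -/
theorem Mechanism.Successful.not_of_user_eq_attacker {M : Mechanism n} {σ τ : Scenario n}
    (hσ : M.Successful σ) (hτ : M.Successful τ) (h : σ.user = τ.attacker) : False := by
  obtain ⟨S₀, hS₀, h₀⟩ := hσ
  obtain ⟨S₁, -, h₁⟩ := hτ
  let v : Tape := fun _ => false
  have w₀ : ∃ t, ((execute M (versus S₀ S₁.mute) (delayOne false) t).run v).1.decision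
      = some false := by
    -- Against the muted attacker the scheduler is reliable: at time `k + 1` all pending messages
    -- were sent at time `k` or later.
    refine exists_decision_eq (assign_false (delayOne false) rfl _ _)
      (h₀ S₁.mute (S₁.mute_sends _) (delayOne false) v) fun k => ⟨k + 1, by omega, ?_⟩
    refine (execute_mute_pending M S₀ S₁ false (k + 1) v).imp_right fun ⟨ha, hb⟩ => ⟨?_, ?_⟩
    · intro p hp
      have := (ha p hp).2
      omega
    · intro i p hp
      have := hb i p hp
      omega
  obtain ⟨T, hT⟩ := w₀
  -- The same decision is reached with `S₁` unmuted and the roles of user and attacker exchanged.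
  rw [(execute_sameUpToOne M S₀ S₁ false true T v).1.decision] at hT
  have w₁ : ∃ t, ((execute M (versus S₀ S₁) (delayOne true) t).run v).1.decision
      = some true := by
    -- From time `T` on the execution has ended, so reliability holds although player `1` was never
    -- heard. By `h`, `S₀` may act as the attacker of `τ`.
    refine exists_decision_eq (assign_true (delayOne true) rfl _ _)
      (h₁ S₀ (h ▸ hS₀) (delayOne true) v) fun k => ⟨max k T, le_max_left _ _, Or.inl ?_⟩
    rw [decision_mono M _ _ v (le_max_right k T) hT]
    simp
  obtain ⟨T', hT'⟩ := w₁
  have a := decision_mono M _ _ v (le_max_left T T') hT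
  have b := decision_mono M _ _ v (le_max_right T T') hT'
  rw [a] at b
  simp at b

/-! ### Boolean mechanisms -/

open Classical in
/-- The decision of the Boolean mechanism of `f` if its first message is `m`, from player `i`. -/
noncomputable def verdict (f : Availability n → Bool) (i : PlayerId) (m : Message n) : PlayerId :=
  if m.Valid ∧ f m.availability = true then i else !i

theorem booleanMechanism_receive_some (g : Generator n) (f : Availability n → Bool) (t : ℕ)
    (i : PlayerId) (m : Message n) (ms : List (Option (PlayerId × Message n))) :
    (booleanMechanism g f).receive t () (some (i, m) :: ms)
      = pure ⟨(), some (verdict f i m), fun _ => []⟩ := rfl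

theorem booleanMechanism_receive_none (g : Generator n) (f : Availability n → Bool) (t : ℕ) :
    (booleanMechanism g f).receive t () [none] = pure ⟨(), none, fun _ => []⟩ := rfl

theorem Message.SendableBy.availability_le {m : Message n} {a : Availability n}
    (h : m.SendableBy a) : m.availability ≤ a := by
  intro i hi
  exact h i (by simpa [Message.availability] using hi)

/-- The message that presents exactly the credentials in `a`. -/
def fullMessage (a : Availability n) : Message n where
  text := []
  creds := (Finset.univ.filter fun i => a i = true).image Presented.secret

theorem fullMessage_valid (a : Availability n) : (fullMessage a).Valid := by
  intro c hc
  simp only [fullMessage, Finset.mem_image] at hc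
  obtain ⟨i, -, rfl⟩ := hc
  exact ⟨i, rfl⟩

theorem fullMessage_availability (a : Availability n) : (fullMessage a).availability = a := by
  funext i
  simp [Message.availability, fullMessage]

theorem fullMessage_sendableBy (a : Availability n) : (fullMessage a).SendableBy a := by
  intro i
  simp [fullMessage]

/-- The strategy that sends all available credentials in each step. -/
def presentAll (a : Availability n) : Strategy n where
  State := Unit
  init := ()
  step := fun _ _ _ => pure ((), [fullMessage a])

theorem presentAll_sends (a : Availability n) {P : Message n → Prop} (h : P (fullMessage a)) :
    (presentAll a).Sends P := by
  intro s t m x hx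
  rw [List.mem_singleton.1 hx]
  exact h

theorem presentAll_receive (a : Availability n) (t : ℕ) (s : (presentAll a).State)
    (m : Option Text) (ms : List (Option Text)) :
    (presentAll a).receive t s (m :: ms) =
      (do let r ← (presentAll a).receive t () ms; pure (r.1, fullMessage a :: r.2)) := rfl

/-- Any delivered message forces a decision, so an undecided mechanism has received nothing and the
first message of the user is still pending. -/
theorem execute_booleanMechanism (g : Generator n) (f : Availability n → Bool)
    (S : PlayerId → Strategy n) (γ : Scheduler)
    (hS : ∀ i, (S i).Sends fun m => verdict f i m = γ.userId)
    (hU : ∃ a, S γ.userId = presentAll a) (v : Tape) (t : ℕ) :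
    ((execute (booleanMechanism g f) S γ t).run v).1.decision = some γ.userId ∨
      (((execute (booleanMechanism g f) S γ t).run v).1.decision = none ∧
        (∀ p ∈ ((execute (booleanMechanism g f) S γ t).run v).1.toMech,
          verdict f p.body.1 p.body.2 = γ.userId) ∧
        (0 < t → ∃ p ∈ ((execute (booleanMechanism g f) S γ t).run v).1.toMech,
          p.header.sentAt = 0)) := by
  induction t with
  | zero => right; simp [execute, setup]
  | succ t ih =>
    simp only [execute, Coin.run_bind]
    generalize (execute (booleanMechanism g f) S γ t).run v = x at ih
    obtain ⟨⟨d, m, p, q, r⟩, w⟩ := x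
    dsimp only at ih ⊢
    rcases ih with rfl | ⟨rfl, hq, h0⟩
    · left; simp [round]
    -- The trailing empty message calls the user in every round, including time `0`.
    have hne : ∀ ms w,
        (((S γ.userId).receive t (p γ.userId) (ms ++ [none])).run w).1.2 ≠ [] := by
      intro ms w
      obtain ⟨a, ha⟩ := hU
      generalize p γ.userId = s
      generalize S γ.userId = S' at ha s
      subst ha
      cases ms <;> simp [presentAll_receive]
    have hgood : ∀ i ms w, ∀ x ∈ (((S i).receive t (p i) ms).run w).1.2,
        verdict f i x = γ.userId := fun i ms w => ((hS i).receive t (p i) ms).run w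
    cases m
    simp only [round, Coin.run_bind, Coin.run_pure]
    rcases hd : delivered (chosen (booleanMechanism g f) S γ t ⟨none, (), p, q, r⟩ .mechanism) q
      with _ | ⟨⟨h, i, m⟩, ps⟩
    · right
      simp only [List.map_nil, List.nil_append, booleanMechanism_receive_none, Coin.run_pure]
      refine ⟨trivial, ?_, ?_⟩
      · intro y hy
        simp only [List.mem_append, List.mem_map] at hy
        rcases hy with (hy | ⟨m, hm, rfl⟩) | ⟨m, hm, rfl⟩
        · exact hq y (remaining_subset _ _ hy)
        · exact hgood _ _ _ m hm
        · exact hgood _ _ _ m hm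
      · intro _
        rcases Nat.eq_zero_or_pos t with rfl | ht
        · rcases hu : γ.userId with _ | _
          · rw [hu] at hne
            obtain ⟨m, hm⟩ := List.exists_mem_of_ne_nil _ (hne _ _)
            exact ⟨_, List.mem_append_left _ (List.mem_append_right _ (List.mem_map_of_mem hm)),
              rfl⟩
          · rw [hu] at hne
            obtain ⟨m, hm⟩ := List.exists_mem_of_ne_nil _ (hne _ _)
            exact ⟨_, List.mem_append_right _ (List.mem_map_of_mem hm), rfl⟩
        · obtain ⟨y, hy, hy0⟩ := h0 ht
          exact ⟨y, List.mem_append_left _ (List.mem_append_left _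
            (mem_remaining_of_delivered_eq_nil hd hy)), hy0⟩
    · left
      simp only [List.map_cons, List.cons_append, booleanMechanism_receive_some, Coin.run_pure]
      exact congrArg some (hq ⟨h, i, m⟩ (delivered_subset _ _ (hd ▸ List.mem_cons_self)))

/-- Whichever player is heard first, the user wins: by monotonicity no subset of the attacker's
credentials satisfies `f`. -/
theorem booleanMechanism_successful (g : Generator n) (f : Availability n → Bool)
    (hf : Monotone f) {σ : Scenario n} (hU : f σ.user = true) (hA : f σ.attacker = false) :
    (booleanMechanism g f).Successful σ := by
  refine ⟨presentAll σ.user, presentAll_sends _ (fullMessage_sendableBy _), ?_⟩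
  intro SA hSA γ v hrel
  have hS : ∀ i, (assign γ (presentAll σ.user) SA i).Sends
      fun m => verdict f i m = γ.userId := by
    intro i
    by_cases h : i = γ.userId
    · simp only [assign, if_pos h]
      refine presentAll_sends _ ?_
      rw [verdict, if_pos ⟨fullMessage_valid _, by rwa [fullMessage_availability]⟩, h]
    · simp only [assign, if_neg h]
      intro s t m
      have hlose : ∀ x : Message n, x.SendableBy σ.attacker → verdict f i x = γ.userId := by
        intro x hx
        rw [verdict, if_neg]
        · revert h; cases i <;> cases γ.userId <;> simp
        · rintro ⟨-, h'⟩
          have := hf hx.availability_le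
          rw [h', hA] at this
          exact absurd this (by decide)
      exact (hSA s t m).mono fun r hr x hx => hlose x (hr x hx)
  have hinv := execute_booleanMechanism g f _ γ hS ⟨σ.user, by simp [assign]⟩ v
  -- Reliability with `k = 1` rules out that the user's time-`0` message stays pending forever.
  obtain ⟨t, ht, hdone⟩ := hrel 1
  refine ⟨t, (hinv t).resolve_right ?_⟩
  rintro ⟨hnone, -, hp⟩
  obtain ⟨p, hp, hp0⟩ := hp ht
  have := (hdone.resolve_left fun h => h hnone).1 p hp
  omega

theorem equivalent_booleanMechanism_of_dominates (f : Availability n → Bool) (hf : Monotone f)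
    (hconst : ∃ x y, f x ≠ f y) (g : Generator n) (M' : Mechanism n)
    (hdom : Dominates M' (booleanMechanism g f)) : Equivalent M' (booleanMechanism g f) := by
  have hdom' : ∀ a b, f a = true → f b = false → M'.Successful ⟨a, b⟩ := fun a b ha hb =>
    hdom (booleanMechanism_successful g f hf (σ := ⟨a, b⟩) ha hb)
  obtain ⟨one, zero, h1, h0⟩ : ∃ x y, f x = true ∧ f y = false := by
    obtain ⟨x, y, hxy⟩ := hconst
    cases hx : f x <;> cases hy : f y
    · exact absurd (hx.trans hy.symm) hxy
    · exact ⟨y, x, hy, hx⟩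
    · exact ⟨x, y, hx, hy⟩
    · exact absurd (hx.trans hy.symm) hxy
  refine Set.Subset.antisymm (fun σ (hσ : M'.Successful σ) => ?_) hdom
  refine booleanMechanism_successful g f hf ?_ ?_
  -- If `f` is 0 at the user, `M'` also succeeds when these credentials are the attacker's, against
  -- a user with `one`.
  · by_contra h
    exact hσ.not_of_user_eq_attacker (hdom' one σ.user h1 (by simpa using h)) rfl
  -- If `f` is 1 at the attacker, `M'` also succeeds with these credentials as the user's, against
  -- `zero`.
  · by_contra h
    exact (hdom' σ.attacker zero (by simpa using h) h0).not_of_user_eq_attacker hσ rfl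

end Execution

end AsyncAuth

/-- Let `f` be a non-constant monotone Boolean function. Then the Boolean mechanism of `f` (with any
ideal credential generator) is maximal: no mechanism strictly dominates it, that is, every mechanism
that dominates it has exactly the same profile. -/
theorem mainTheorem4 (n : ℕ) (f : AsyncAuth.Availability n → Bool) (hmono : Monotone f)
    (hconst : ∃ x y, f x ≠ f y) (g : AsyncAuth.Generator n) :
    (AsyncAuth.booleanMechanism g f).Maximal ∧
      ∀ M' : AsyncAuth.Mechanism n, AsyncAuth.Dominates M' (AsyncAuth.booleanMechanism g f) →
        AsyncAuth.Equivalent M' (AsyncAuth.booleanMechanism g f) := by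
  have key := AsyncAuth.equivalent_booleanMechanism_of_dominates f hmono hconst g
  exact ⟨fun ⟨M', h⟩ => h.2 (key M' h.1).subset, key⟩
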